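/- Let $\mathbb T\subseteq\mathbb R$ be a non-empty closed set (a time scale), $a,b\in\mathbb T$ with $a<b$, and regard $J=[a,b]_{\mathbb T}=[a,b]\cap\mathbb T$ as a time scale, with forward jump $\sigma$, backward jump $\rho$, graininess $\mu(t)=\sigma(t)-t$ (where $\sigma(b)=b$, $\rho(a)=a$), $J^\kappa=J\setminus\{b\}$ if $\rho(b)<b$ and $J^\kappa=J$ otherwise, and the (entrywise) delta derivative $X^\Delta$ of matrix-valued functions. A real matrix $M$ is called positive definite, $M>0$, if it is symmetric and $z^TMz>0$ for all $z\ne0$; for real square matrices $M\le N$ means $z^TMz\le z^TNz$ for all $z$. Let $S\subseteq\mathbb R^{n\times n}$, $A\in\mathbb R^{n\times n}$, and let $F:J^\kappa\times S\to\mathbb R^{n\times n}$ be right-Hilger-continuous, i.e. $F$ is continuous at each $(t,P)$ with $\sigma(t)=t$, and the limits $\lim_{(s,Q)\to(t^-,P)}F(s,Q)$ and $\lim_{Q\to P}F(t,Q)$ exist and are finite at each $(t,P)$ with $\rho(t)=t$. Let $C:J\to\mathbb R^{n\times n}$ be such that $C(t)$ is positive definite for all $t\in J$ and 1. $C$ is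 rd-continuous on $J$ (continuous at $t$ if $\sigma(t)=t$, with a finite left limit at $t$ if $\rho(t)=t$); 2. the matrix exponential function $e_C(\cdot,a)$, i.e. the solution of $Y^\Delta=C(t)Y$ on $J^\kappa$, $Y(a)=I$, satisfies: for each $t\in J$, $e_C(t,a)$ commutes with $C(t)$ and with every $P\in S$. Write $\ominus C(t)=-[I+\mu(t)C(t)]^{-1}C(t)$. Suppose that for any two distinct elements of $S$, named $P$ and $Q$ in a suitable order, $P-Q$ is positive definite and increasing along the equation, i.e. for all $t\in J^\kappa$ $$P-Q>0\qquad\text{and}\qquad F(t,P)-F(t,Q)>0,$$ and that the inverse Lipschitz condition $$(P-Q)^{-1}\le(-\ominus C(t))\,\bigl(F(t,P)-F(t,Q)\bigr)^{-1}\qquad\text{for all }t\in J^\kappa$$ holds. Then the initial value problem $$X^\Delta=F(t,X^\sigma)\quad(t\in J^\kappa),\qquad X(a)=A,$$ where $X^\sigma=X\circ\sigma$, has at most one solution $X$ on $J$ with $X(t)\in S$ for all $t\in J$. -/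

import Mathlib

open scoped Topology Matrix

namespace TimeScale

/-- The forward jump operator of the time scale `T`, with `σ (max T) = max T`. -/
noncomputable def sigma (T : Set ℝ) (t : ℝ) : ℝ :=
  open scoped Classical in
  if (T ∩ Set.Ioi t).Nonempty then sInf (T ∩ Set.Ioi t) else t

/-- The backward jump operator of the time scale `T`, with `ρ (min T) = min T`. -/
noncomputable def rho (T : Set ℝ) (t : ℝ) : ℝ :=
  open scoped Classical in
  if (T ∩ Set.Iio t).Nonempty then sSup (T ∩ Set.Iio t) else t

/-- The graininess function `μ(t) = σ(t) - t`. -/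
noncomputable def mu (T : Set ℝ) (t : ℝ) : ℝ := sigma T t - t

/-- `T^κ`: the time scale `T` without its maximum, if that maximum is left-scattered. -/
def kappa (T : Set ℝ) : Set ℝ := {t | t ∈ T ∧ ¬ (IsGreatest T t ∧ rho T t < t)}

/-- `x : T → ℝ` has delta-derivative `x'` at `t`. -/
def HasDeltaDerivAt (T : Set ℝ) (x : ℝ → ℝ) (x' : ℝ) (t : ℝ) : Prop :=
  ∀ ε > 0, ∃ δ > 0, ∀ s ∈ T, |s - t| < δ →
    |(x (sigma T t) - x s) - x' * (sigma T t - s)| ≤ ε * |sigma T t - s|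

/-- The delta-derivative of a matrix-valued function is taken entrywise. -/
def HasMatrixDeltaDerivAt {n : ℕ} (T : Set ℝ) (X : ℝ → Matrix (Fin n) (Fin n) ℝ)
    (X' : Matrix (Fin n) (Fin n) ℝ) (t : ℝ) : Prop :=
  ∀ i j, HasDeltaDerivAt T (fun s => X s i j) (X' i j) t

/-- Rd-continuity on `T`: continuity at right-dense points, finite left limits at
left-dense points. (The topology on matrices is the entrywise one.) -/
def RdContinuous {n : ℕ} (T : Set ℝ) (K : ℝ → Matrix (Fin n) (Fin n) ℝ) : Prop :=
  (∀ t ∈ T, sigma T t = t → ContinuousWithinAt K T t) ∧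
  (∀ t ∈ T, rho T t = t → ∃ L, Filter.Tendsto K (𝓝[T ∩ Set.Iio t] t) (𝓝 L))

/-- Right-Hilger-continuity of `F : T^κ × S → ℝ^{n × n}`. -/
def RightHilgerContinuous {n : ℕ} (T : Set ℝ) (S : Set (Matrix (Fin n) (Fin n) ℝ))
    (F : ℝ → Matrix (Fin n) (Fin n) ℝ → Matrix (Fin n) (Fin n) ℝ) : Prop :=
  (∀ t ∈ kappa T, sigma T t = t → ∀ P ∈ S,
    ContinuousWithinAt (Function.uncurry F) (kappa T ×ˢ S) (t, P)) ∧
  (∀ t ∈ kappa T, rho T t = t → ∀ P ∈ S,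
    (∃ L, Filter.Tendsto (Function.uncurry F)
      (𝓝[(kappa T ∩ Set.Iio t) ×ˢ S] (t, P)) (𝓝 L)) ∧
    (∃ L, Filter.Tendsto (F t) (𝓝[S \ {P}] P) (𝓝 L)))

/-- `(⊖K)(t) = -[I + μ(t) K(t)]⁻¹ K(t)`. -/
noncomputable def ominus {n : ℕ} (T : Set ℝ) (K : ℝ → Matrix (Fin n) (Fin n) ℝ) (t : ℝ) :
    Matrix (Fin n) (Fin n) ℝ :=
  -((1 + mu T t • K t)⁻¹ * K t)

/-- `E = e_K(·, a)` is the matrix exponential function of `K` on `T`: the solution of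
`Y^Δ = K(t) Y`, `Y(a) = I`. -/
def IsMatrixExp {n : ℕ} (T : Set ℝ) (a : ℝ) (K E : ℝ → Matrix (Fin n) (Fin n) ℝ) : Prop :=
  E a = 1 ∧ ∀ t ∈ kappa T, HasMatrixDeltaDerivAt T E (K t * E t) t

/-- The order on square matrices: `A ≤ B` iff `zᵀ A z ≤ zᵀ B z` for all vectors `z`. -/
def QuadLE {n : ℕ} (A B : Matrix (Fin n) (Fin n) ℝ) : Prop :=
  ∀ z : Fin n → ℝ, z ⬝ᵥ (A *ᵥ z) ≤ z ⬝ᵥ (B *ᵥ z)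

/-- `X` is a solution in `S`, on the time scale `T`, of the initial value problem
`X^Δ = F(t, X^σ)`, `X(a) = A`. -/
def IsShiftedSolution {n : ℕ} (T : Set ℝ) (a : ℝ) (A : Matrix (Fin n) (Fin n) ℝ)
    (S : Set (Matrix (Fin n) (Fin n) ℝ))
    (F : ℝ → Matrix (Fin n) (Fin n) ℝ → Matrix (Fin n) (Fin n) ℝ)
    (X : ℝ → Matrix (Fin n) (Fin n) ℝ) : Prop :=
  X a = A ∧ (∀ t ∈ T, X t ∈ S) ∧
    ∀ t ∈ kappa T, HasMatrixDeltaDerivAt T X (F t (X (sigma T t))) t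

end TimeScale

/-! ### Trace and order estimates for positive semidefinite matrices -/

namespace Matrix

variable {ι : Type*} [Fintype ι]

/-! The matrix problem reduces to a scalar one for `r = tr (X - Y)`. Where `r^σ > 0`, the sign of
the trace forces `R = X^σ - Y^σ` to be positive definite, so the inverse Lipschitz condition
applies. With `M` bounding `tr C` on `J` and `k = M / (1 + μ M)`, the resolvent bound `-⊖C ≤ k`
turns that condition into `r^Δ ≤ k r^σ` (`trace_le_of_quadLE_inv`).

Since `1 - μ k = 1 / (1 + μ M)`, this is an implicit form of growth at rate `M`, and a Gronwall
argument (`nonpos_of_deltaDeriv_le`) gives `r ≤ 0`. Exchanging `X` and `Y` gives `r = 0`, whereas a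
definite difference has nonzero trace. -/

theorem PosSemidef.trace_mul_nonneg {A B : Matrix ι ι ℝ} (hA : A.PosSemidef)
    (hB : B.PosSemidef) : 0 ≤ (A * B).trace := by
  classical
  open scoped MatrixOrder in
  obtain ⟨V, hV⟩ := CStarAlgebra.nonneg_iff_eq_star_mul_self.mp hB.nonneg
  rw [hV, ← mul_assoc, trace_mul_comm, ← mul_assoc]
  exact (hA.mul_mul_conjTranspose_same V).trace_nonneg

/-- This is Cauchy–Schwarz. Tracing its product with `C` bounds `zᵀ C z` by `tr C · zᵀ z` without
eigenvalues. -/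
theorem posSemidef_dotProduct_self_smul_one_sub_vecMulVec [DecidableEq ι] (z : ι → ℝ) :
    ((z ⬝ᵥ z) • (1 : Matrix ι ι ℝ) - vecMulVec z z).PosSemidef := by
  refine .of_dotProduct_mulVec_nonneg (.sub ?_ ?_) fun w => ?_
  · exact isHermitian_one.smul (IsSelfAdjoint.all _)
  · simp [IsHermitian]
  · have h := Finset.sum_mul_sq_le_sq_mul_sq Finset.univ z w
    simp only [pow_two] at h
    change (z ⬝ᵥ w) * (z ⬝ᵥ w) ≤ (z ⬝ᵥ z) * (w ⬝ᵥ w) at h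
    simp only [star_trivial, sub_mulVec, smul_mulVec, one_mulVec, dotProduct_sub,
      dotProduct_smul, vecMulVec_mulVec, smul_eq_mul, MulOpposite.smul_eq_mul_unop,
      MulOpposite.unop_op]
    rw [dotProduct_comm w z]
    linarith

theorem PosSemidef.smul_one_sub_of_trace_le [DecidableEq ι] {C : Matrix ι ι ℝ}
    (hC : C.PosSemidef) {M : ℝ} (hM : C.trace ≤ M) :
    (M • (1 : Matrix ι ι ℝ) - C).PosSemidef := by
  refine .of_dotProduct_mulVec_nonneg
    ((isHermitian_one.smul (IsSelfAdjoint.all _)).sub hC.1) fun z => ?_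
  have h := hC.trace_mul_nonneg (posSemidef_dotProduct_self_smul_one_sub_vecMulVec z)
  rw [mul_sub, trace_sub, mul_smul_comm, trace_smul, mul_one, mul_vecMulVec, trace_vecMulVec,
    dotProduct_comm (C *ᵥ z)] at h
  have hz : 0 ≤ z ⬝ᵥ z := by simpa using dotProduct_star_self_nonneg z
  simp only [star_trivial, sub_mulVec, smul_mulVec, one_mulVec, dotProduct_sub,
    dotProduct_smul, smul_eq_mul] at h ⊢
  nlinarith [mul_le_mul_of_nonneg_right hM hz]

/-- If `0 ≤ C ≤ M` then `C (M - C)` is positive semidefinite. -/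
theorem PosSemidef.mul_smul_one_sub [DecidableEq ι] {C : Matrix ι ι ℝ} (hC : C.PosSemidef)
    {M : ℝ} (hM : 0 < M) (hCM : (M • (1 : Matrix ι ι ℝ) - C).PosSemidef) :
    (C * (M • (1 : Matrix ι ι ℝ) - C)).PosSemidef := by
  set D := M • (1 : Matrix ι ι ℝ) - C with hD
  have h₁ := hCM.conjTranspose_mul_mul_same C
  have h₂ := hC.conjTranspose_mul_mul_same D
  rw [hC.1.eq] at h₁
  rw [hCM.1.eq] at h₂
  -- As `D = M - C` commutes with `C`, `C D C + D C D = C D (C + D) = M C D`.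
  have h := (h₁.add h₂).smul (a := M⁻¹) (by positivity)
  convert h using 1
  rw [eq_inv_smul_iff₀ hM.ne', hD]
  simp only [mul_sub, sub_mul, smul_mul_assoc, mul_smul_comm, mul_one, one_mul, smul_sub, mul_assoc]
  module

theorem PosDef.one_add_smul {κ : Type*} [DecidableEq κ] {C : Matrix κ κ ℝ} (hC : C.PosDef) {μ : ℝ}
    (hμ : 0 ≤ μ) : (1 + μ • C).PosDef :=
  PosDef.one.add_posSemidef (hC.posSemidef.smul hμ)

/-- If `0 < C ≤ M` then `(1 + μ C)⁻¹ C ≤ M / (1 + μ M)`. -/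
theorem PosDef.smul_one_sub_resolvent_mul [DecidableEq ι] {C : Matrix ι ι ℝ} (hC : C.PosDef)
    {M μ : ℝ} (hM : 0 < M) (hμ : 0 ≤ μ) (hCM : (M • (1 : Matrix ι ι ℝ) - C).PosSemidef) :
    ((M / (1 + μ * M)) • (1 : Matrix ι ι ℝ) - (1 + μ • C)⁻¹ * C).PosSemidef := by
  have hU := hC.one_add_smul hμ
  have hd : IsUnit (1 + μ • C).det := (isUnit_iff_isUnit_det _).1 hU.isUnit
  have hμM : 0 < 1 + μ * M := by positivity
  -- Up to the factor `1 / (1 + μ M)` this is `(M - C)(1 + μ C)`; conjugating by the resolvent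
  -- leaves the wanted difference.
  have h := (hCM.add ((hC.posSemidef.mul_smul_one_sub hM hCM).smul hμ)).smul
    (a := (1 + μ * M)⁻¹) (by positivity)
  have h' := h.conjTranspose_mul_mul_same (1 + μ • C)⁻¹
  rw [hU.inv.1.eq] at h'
  convert h' using 1
  have key : (1 + μ * M)⁻¹ • (M • (1 : Matrix ι ι ℝ) - C + μ • (C * (M • (1 : Matrix ι ι ℝ) - C)))
      = ((M / (1 + μ * M)) • (1 + μ • C) - C) * (1 + μ • C) := by
    rw [inv_smul_eq_iff₀ hμM.ne']
    simp only [mul_sub, sub_mul, add_mul, mul_add, smul_mul_assoc, mul_smul_comm, mul_one, one_mul,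
      smul_sub, smul_add, smul_smul]
    match_scalars <;> field_simp <;> ring
  rw [key, mul_assoc, mul_assoc, mul_nonsing_inv _ hd, mul_one, mul_sub, mul_smul_comm,
    nonsing_inv_mul _ hd]

end Matrix

namespace TimeScale

open Matrix

theorem QuadLE.trace_le {n : ℕ} {A B : Matrix (Fin n) (Fin n) ℝ} (h : QuadLE A B) :
    A.trace ≤ B.trace := by
  refine Finset.sum_le_sum fun i _ => ?_
  simpa using h (Pi.single i 1)

theorem QuadLE.transpose_mul_mul_same {n : ℕ} {A B : Matrix (Fin n) (Fin n) ℝ} (h : QuadLE A B)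
    (G : Matrix (Fin n) (Fin n) ℝ) : QuadLE (Gᵀ * A * G) (Gᵀ * B * G) := fun z => by
  simpa only [← mulVec_mulVec, dotProduct_mulVec, vecMul_transpose] using h (G *ᵥ z)

/-- If `R⁻¹ ≤ K G⁻¹` and `K ≤ k`, then `tr G ≤ k tr R`. -/
theorem trace_le_of_quadLE_inv {n : ℕ} {G R K : Matrix (Fin n) (Fin n) ℝ} {k : ℝ}
    (hG : G.PosDef) (hR : R.PosDef) (hk : 0 < k)
    (hK : (k • (1 : Matrix (Fin n) (Fin n) ℝ) - K).PosSemidef) (h : QuadLE R⁻¹ (K * G⁻¹)) :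
    G.trace ≤ k * R.trace := by
  have hGd : IsUnit G.det := (isUnit_iff_isUnit_det _).1 hG.isUnit
  have hRd : IsUnit R.det := (isUnit_iff_isUnit_det _).1 hR.isUnit
  have hGt : Gᵀ = G := by simpa using hG.1.eq
  have h₁ := (h.transpose_mul_mul_same G).trace_le
  rw [hGt, mul_assoc G (K * G⁻¹), mul_assoc K, nonsing_inv_mul _ hGd, mul_one] at h₁
  have h₂ := hG.posSemidef.trace_mul_nonneg hK
  rw [mul_sub, trace_sub, mul_smul_comm, trace_smul, mul_one, smul_eq_mul] at h₂
  -- Completing the square bounds `tr (G R⁻¹ G)` below by `2k tr G - k² tr R`, while `h₁` and `h₂`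
  -- bound it above by `k tr G`.
  have h₃ := (hR.inv.posSemidef.conjTranspose_mul_mul_same (G - k • R)).trace_nonneg
  rw [(hG.1.sub (hR.1.smul (IsSelfAdjoint.all k))).eq] at h₃
  have e : (G - k • R) * R⁻¹ * (G - k • R) = G * R⁻¹ * G - (2 * k) • G + (k * k) • R := by
    simp only [sub_mul, mul_sub, smul_mul_assoc, mul_smul_comm, mul_nonsing_inv _ hRd, one_mul,
      mul_assoc, nonsing_inv_mul _ hRd, mul_one]
    module
  rw [e, trace_add, trace_sub, trace_smul, trace_smul, smul_eq_mul, smul_eq_mul] at h₃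
  have : k * G.trace ≤ k * (k * R.trace) := by linarith
  exact le_of_mul_le_mul_left this hk

end TimeScale

/-! ### Jump operators, rd-continuity and the delta derivative -/

namespace TimeScale

open Filter Set Asymptotics

variable {T : Set ℝ} {t u : ℝ}

theorem le_sigma (T : Set ℝ) (t : ℝ) : t ≤ sigma T t := by
  unfold sigma
  split_ifs with h
  · exact le_csInf h fun s hs => hs.2.le
  · exact le_rfl

theorem sigma_le {s : ℝ} (hs : s ∈ T) (hts : t < s) : sigma T t ≤ s := by
  rw [sigma, if_pos ⟨s, hs, hts⟩]
  exact csInf_le ⟨t, fun _ h => h.2.le⟩ ⟨hs, hts⟩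

theorem rho_le (T : Set ℝ) (t : ℝ) : rho T t ≤ t := by
  unfold rho
  split_ifs with h
  · exact csSup_le h fun s hs => hs.2.le
  · exact le_rfl

theorem le_rho {s : ℝ} (hs : s ∈ T) (hst : s < t) : s ≤ rho T t := by
  rw [rho, if_pos ⟨s, hs, hst⟩]
  exact le_csSup ⟨t, fun _ h => h.2.le⟩ ⟨hs, hst⟩

theorem sigma_mem (hT : IsClosed T) (ht : t ∈ T) : sigma T t ∈ T := by
  unfold sigma
  split_ifs with h
  · exact hT.closure_subset_iff.2 inter_subset_left (csInf_mem_closure h ⟨t, fun _ h => h.2.le⟩)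
  · exact ht

theorem rho_mem_closure (h : (T ∩ Iio t).Nonempty) : rho T t ∈ closure (T ∩ Iio t) := by
  rw [rho, if_pos h]
  exact csSup_mem_closure h ⟨t, fun _ h => h.2.le⟩

theorem sigma_rho (ht : t ∈ T) (h : rho T t < t) : sigma T (rho T t) = t := by
  refine le_antisymm (sigma_le ht h) ?_
  rw [sigma, if_pos ⟨t, ht, h⟩]
  exact le_csInf ⟨t, ht, h⟩ fun s hs => not_lt.1 fun hst => (le_rho hs.1 hst).not_gt hs.2

theorem mem_kappa_of_lt {s : ℝ} (ht : t ∈ T) (hs : s ∈ T) (hts : t < s) : t ∈ kappa T :=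
  ⟨ht, fun h => (h.1.2 hs).not_gt hts⟩

theorem nhdsWithin_inter_Ioi_eq_bot (h : sigma T t ≠ t) : 𝓝[T ∩ Ioi t] t = ⊥ := by
  have hlt := lt_of_le_of_ne (le_sigma T t) h.symm
  refine empty_mem_iff_bot.1 ?_
  filter_upwards [self_mem_nhdsWithin, mem_nhdsWithin_of_mem_nhds (Iio_mem_nhds hlt)] with s hs hs'
  exact (sigma_le hs.1 hs.2).not_gt hs'

theorem nhdsWithin_inter_Iio_eq_bot (h : rho T t ≠ t) : 𝓝[T ∩ Iio t] t = ⊥ := by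
  have hlt := lt_of_le_of_ne (rho_le T t) h
  refine empty_mem_iff_bot.1 ?_
  filter_upwards [self_mem_nhdsWithin, mem_nhdsWithin_of_mem_nhds (Ioi_mem_nhds hlt)] with s hs hs'
  exact (le_rho hs.1 hs.2).not_gt hs'

theorem nhdsWithin_eq_sup (ht : t ∈ T) :
    𝓝[T] t = 𝓝[T ∩ Iio t] t ⊔ (pure t ⊔ 𝓝[T ∩ Ioi t] t) := by
  rw [← nhdsWithin_singleton, ← nhdsWithin_union, ← nhdsWithin_union]
  congr 1
  ext s
  simp only [mem_union, mem_inter_iff, mem_Iio, mem_singleton_iff, mem_Ioi]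
  constructor
  · intro hs
    rcases lt_trichotomy s t with h | h | h <;> simp [h, hs]
  · rintro (h | rfl | h)
    exacts [h.1, ht, h.1]

/-- By compactness a local bound suffices. On each side of a point there is either a finite limit or
no nearby point of `T`. -/
theorem RdContinuous.bddAbove_image {n : ℕ} {K : ℝ → Matrix (Fin n) (Fin n) ℝ}
    (hK : RdContinuous T K) (hT : IsCompact T) {φ : Matrix (Fin n) (Fin n) ℝ → ℝ}
    (hφ : Continuous φ) : BddAbove ((fun t => φ (K t)) '' T) := by
  refine hT.induction_on (p := fun s => BddAbove ((fun t => φ (K t)) '' s)) (by simp)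
    (fun s t hst h => h.mono (image_mono hst)) (fun s t hs ht => by
      rw [image_union]; exact hs.union ht) fun t ht => ?_
  have hr : IsBoundedUnder (· ≤ ·) (𝓝[T ∩ Ioi t] t) fun s => φ (K s) := by
    by_cases h : sigma T t = t
    · exact ((hφ.tendsto _).comp
        ((hK.1 t ht h).mono_left (nhdsWithin_mono _ inter_subset_left))).isBoundedUnder_le
    · rw [nhdsWithin_inter_Ioi_eq_bot h]
      exact ⟨0, by simp⟩
  have hl : IsBoundedUnder (· ≤ ·) (𝓝[T ∩ Iio t] t) fun s => φ (K s) := by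
    by_cases h : rho T t = t
    · obtain ⟨L, hL⟩ := hK.2 t ht h
      exact ((hφ.tendsto _).comp hL).isBoundedUnder_le
    · rw [nhdsWithin_inter_Iio_eq_bot h]
      exact ⟨0, by simp⟩
  obtain ⟨Mr, hMr⟩ := hr
  obtain ⟨Ml, hMl⟩ := hl
  rw [eventually_map] at hMr hMl
  refine ⟨{s | φ (K s) ≤ max Ml (max (φ (K t)) Mr)}, ?_, ⟨_, forall_mem_image.2 fun s hs => hs⟩⟩
  rw [nhdsWithin_eq_sup ht]
  refine mem_sup.2 ⟨?_, mem_sup.2 ⟨?_, ?_⟩⟩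
  · exact hMl.mono fun s hs => le_max_of_le_left hs
  · exact mem_pure.2 (mem_ofPred.2 (le_max_of_le_right (le_max_left _ _)))
  · exact hMr.mono fun s hs => le_max_of_le_right (le_max_of_le_right hs)

section Deriv

variable {x y : ℝ → ℝ} {x' y' : ℝ}

theorem hasDeltaDerivAt_iff_isLittleO : HasDeltaDerivAt T x x' t ↔
    (fun s => (x (sigma T t) - x s) - x' * (sigma T t - s)) =o[𝓝[T] t]
      fun s => sigma T t - s := by
  rw [isLittleO_iff]
  refine forall₂_congr fun ε _ => ?_
  simp only [Real.norm_eq_abs, Filter.Eventually, Metric.mem_nhdsWithin_iff, gt_iff_lt]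
  refine exists_congr fun δ => and_congr_right fun _ => ?_
  constructor
  · rintro h s ⟨hs, hsT⟩
    exact h s hsT hs
  · intro h s hsT hs
    exact h ⟨hs, hsT⟩

theorem HasDeltaDerivAt.sub (hx : HasDeltaDerivAt T x x' t) (hy : HasDeltaDerivAt T y y' t) :
    HasDeltaDerivAt T (fun s => x s - y s) (x' - y') t := by
  rw [hasDeltaDerivAt_iff_isLittleO] at *
  exact (IsLittleO.sub hx hy).congr_left fun s => by ring

theorem HasDeltaDerivAt.sum {ι : Type*} {I : Finset ι} {x : ι → ℝ → ℝ} {x' : ι → ℝ}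
    (h : ∀ i ∈ I, HasDeltaDerivAt T (x i) (x' i) t) :
    HasDeltaDerivAt T (fun s => ∑ i ∈ I, x i s) (∑ i ∈ I, x' i) t := by
  simp only [hasDeltaDerivAt_iff_isLittleO] at *
  refine (IsLittleO.sum h).congr_left fun s => ?_
  rw [Finset.sum_apply, Finset.sum_sub_distrib, Finset.sum_sub_distrib, Finset.sum_mul]

theorem HasMatrixDeltaDerivAt.trace {n : ℕ} {X : ℝ → Matrix (Fin n) (Fin n) ℝ}
    {X' : Matrix (Fin n) (Fin n) ℝ} (h : HasMatrixDeltaDerivAt T X X' t) :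
    HasDeltaDerivAt T (fun s => (X s).trace) X'.trace t :=
  HasDeltaDerivAt.sum fun i _ => h i i

/-- The defining estimate may be taken at `s = t` itself; then let `ε → 0`. -/
theorem HasDeltaDerivAt.sigma_sub (h : HasDeltaDerivAt T x x' t) (ht : t ∈ T) :
    x (sigma T t) - x t = x' * mu T t := by
  have h' : ∀ ε > 0, |(x (sigma T t) - x t) - x' * (sigma T t - t)| ≤ ε * |sigma T t - t| := by
    intro ε hε
    obtain ⟨δ, hδ, hd⟩ := h ε hε
    exact hd t ht (by simpa using hδ)
  have h₀ : |(x (sigma T t) - x t) - x' * (sigma T t - t)| ≤ 0 := by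
    refine ge_of_tendsto (f := fun ε : ℝ => ε * |sigma T t - t|) (x := 𝓝[>] 0) ?_
      (eventually_mem_nhdsWithin.mono fun ε hε => h' ε hε)
    have : Continuous fun ε : ℝ => ε * |sigma T t - t| := by fun_prop
    simpa using (this.tendsto 0).mono_left nhdsWithin_le_nhds
  exact sub_eq_zero.1 (abs_nonpos_iff.1 h₀)

theorem HasDeltaDerivAt.continuousWithinAt (h : HasDeltaDerivAt T x x' t) (ht : t ∈ T) :
    ContinuousWithinAt x T t := by
  have hO : (fun s => sigma T t - s) =O[𝓝[T] t] (fun _ => (1 : ℝ)) :=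
    (((by fun_prop : Continuous fun s => sigma T t - s).tendsto t).mono_left
      nhdsWithin_le_nhds).isBigO_one ℝ
  have he := (isLittleO_one_iff ℝ).1 ((hasDeltaDerivAt_iff_isLittleO.1 h).trans_isBigO hO)
  have hl : Tendsto (fun s => x (sigma T t) - x' * (sigma T t - s)) (𝓝[T] t)
      (𝓝 (x (sigma T t) - x' * (sigma T t - t))) :=
    ((by fun_prop : Continuous fun s => x (sigma T t) - x' * (sigma T t - s)).tendsto t).mono_left
      nhdsWithin_le_nhds
  have hs := h.sigma_sub ht
  rw [mu] at hs
  have := hl.sub he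
  rw [← hs] at this
  simpa [ContinuousWithinAt] using this

end Deriv

end TimeScale

/-! ### Gronwall comparison and the trace of the difference -/

namespace TimeScale

open Filter Set Asymptotics

/-- A delta-differentiable function starting below `B` and increasing strictly more slowly than `B`
whenever it touches `B` at a right-dense point cannot exceed `B` immediately to the right. -/
theorem HasDeltaDerivAt.exists_le_of_hasDerivAt_gt {T N : Set ℝ} {r B : ℝ → ℝ} {r' B' t : ℝ}
    (hr : HasDeltaDerivAt T r r' t) (ht : t ∈ T) (hσ : sigma T t = t) (hB : HasDerivAt B B' t)
    (hle : r t ≤ B t) (hlt : r t = B t → r' < B') (hN : N ⊆ T ∩ Ioi t) (htN : t ∈ closure N) :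
    ∃ s ∈ N, r s < B s := by
  have : (𝓝[N] t).NeBot := mem_closure_iff_nhdsWithin_neBot.1 htN
  have hNT : N ⊆ T := hN.trans inter_subset_left
  suffices ∀ᶠ s in 𝓝[N] t, r s < B s by
    obtain ⟨s, h₁, h₂⟩ := (this.and self_mem_nhdsWithin).exists
    exact ⟨s, h₂, h₁⟩
  rcases hle.lt_or_eq with h | h
  · exact ((hr.continuousWithinAt ht).mono hNT).tendsto.eventually_lt
      hB.continuousAt.continuousWithinAt.tendsto h
  · have h₁ := (hasDeltaDerivAt_iff_isLittleO.1 hr).mono (nhdsWithin_mono t hNT)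
    have h₂ := (hasDerivAt_iff_isLittleO.1 hB).mono (nhdsWithin_le_nhds (s := N))
    rw [hσ] at h₁
    have hc : 0 < (B' - r') / 3 := by have := hlt h; linarith
    filter_upwards [h₁.bound hc, h₂.bound hc, self_mem_nhdsWithin] with s hs₁ hs₂ hs
    have hst : 0 < s - t := sub_pos.2 (hN hs).2
    rw [Real.norm_eq_abs, Real.norm_eq_abs, abs_sub_comm t s, abs_of_pos hst] at hs₁
    rw [Real.norm_eq_abs, Real.norm_eq_abs, abs_of_pos hst, smul_eq_mul] at hs₂
    have h₃ := (abs_le.1 hs₁).1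
    have h₃' := (abs_le.1 hs₁).2
    have h₄ := (abs_le.1 hs₂).1
    have : 0 < (B' - r') / 3 * (s - t) := mul_pos hc hst
    nlinarith

/-- Gronwall's inequality on a time scale, for the equation `r^Δ = M / (1 + μ M) r^σ`. -/
theorem nonpos_of_deltaDeriv_le {T : Set ℝ} (hT : IsClosed T) {a : ℝ} (haT : IsLeast T a)
    {r r' : ℝ → ℝ} {M : ℝ} (hM : 0 < M)
    (hr : ∀ t ∈ kappa T, HasDeltaDerivAt T r (r' t) t) (ha : r a ≤ 0)
    (hle : ∀ t ∈ kappa T, 0 < r (sigma T t) → r' t ≤ M / (1 + mu T t * M) * r (sigma T t)) :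
    ∀ t ∈ T, r t ≤ 0 := by
  -- The rate `M + 1` instead of `M` makes the barrier strictly steeper at a right-dense contact
  -- point.
  suffices H : ∀ ε > 0, ∀ t ∈ T, r t ≤ ε * Real.exp ((M + 1) * (t - a)) by
    intro t ht
    refine ge_of_tendsto (f := fun ε : ℝ => ε * Real.exp ((M + 1) * (t - a))) (x := 𝓝[>] 0) ?_
      (eventually_mem_nhdsWithin.mono fun ε hε => H ε hε t ht)
    have : Continuous fun ε : ℝ => ε * Real.exp ((M + 1) * (t - a)) := by fun_prop
    simpa using (this.tendsto 0).mono_left nhdsWithin_le_nhds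
  intro ε hε
  set B : ℝ → ℝ := fun t => ε * Real.exp ((M + 1) * (t - a)) with hBdef
  have hB0 : ∀ t, 0 < B t := fun t => by positivity
  have hBd : ∀ t, HasDerivAt B ((M + 1) * B t) t := fun t => by
    have h := ((((hasDerivAt_id t).sub_const a).const_mul (M + 1)).exp).const_mul ε
    refine h.congr_deriv ?_
    change _ = (M + 1) * (ε * Real.exp ((M + 1) * (t - a)))
    simp only [id]
    ring
  by_contra! hne
  obtain ⟨t₀, ht₀, hlt₀⟩ := hne
  set N := {t | t ∈ T ∧ B t < r t} with hN
  have hNne : N.Nonempty := ⟨t₀, ht₀, hlt₀⟩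
  have hNb : BddBelow N := ⟨a, fun s hs => haT.2 hs.1⟩
  set u := sInf N
  have hucl : u ∈ closure N := csInf_mem_closure hNne hNb
  have hu : u ∈ T := hT.closure_subset_iff.2 (fun s hs => hs.1) hucl
  have hbelow : ∀ s ∈ T, s < u → r s ≤ B s := fun s hs hsu =>
    not_lt.1 fun h => (csInf_le hNb ⟨hs, h⟩).not_gt hsu
  rcases le_or_gt (r u) (B u) with hru | hru
  -- The bound holds at `u` but fails arbitrarily close to its right, so `u` is right-dense.
  · have hNu : N ⊆ T ∩ Ioi u := fun s hs => ⟨hs.1, lt_of_le_of_ne (csInf_le hNb hs) (by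
      rintro rfl; exact hs.2.not_ge hru)⟩
    have hσ : sigma T u = u :=
      le_antisymm (le_csInf hNne fun s hs => sigma_le hs.1 (hNu hs).2) (le_sigma T u)
    have huκ : u ∈ kappa T := by
      obtain ⟨s, hs⟩ := hNne
      exact mem_kappa_of_lt hu hs.1 (hNu hs).2
    obtain ⟨s, hs, hlt⟩ := (hr u huκ).exists_le_of_hasDerivAt_gt hu hσ (hBd u) hru
      (fun h => by
        have h' := hle u huκ (by rw [hσ, h]; exact hB0 u)
        rw [mu, hσ, h, sub_self, zero_mul, add_zero, div_one] at h'
        linarith [hB0 u]) hNu hucl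
    exact lt_asymm hlt hs.2
  · have hau : a < u := lt_of_le_of_ne (haT.2 hu) (by
      rintro h
      rw [← h] at hru
      exact (hru.trans_le ha).not_gt (hB0 a))
    rcases (rho_le T u).lt_or_eq with hρ | hρ
    · set p := rho T u
      have hp : p ∈ T := hT.closure_subset_iff.2 inter_subset_left
        (rho_mem_closure ⟨a, haT.1, hau⟩)
      have hσ : sigma T p = u := sigma_rho hu hρ
      have hpκ : p ∈ kappa T := mem_kappa_of_lt hp hu hρ
      have h₁ := (hr p hpκ).sigma_sub hp
      have h₂ := hle p hpκ (by rw [hσ]; exact (hB0 u).trans hru)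
      rw [mu, hσ] at h₁ h₂
      have hm : 0 < u - p := sub_pos.2 hρ
      -- Solving the implicit inequality for `r u` across the jump from `p` to `u`.
      have h₃ : r u ≤ (1 + (u - p) * M) * r p := by
        have hpos : 0 < 1 + (u - p) * M := by positivity
        rw [div_mul_eq_mul_div, le_div_iff₀ hpos] at h₂
        nlinarith [mul_le_mul_of_nonneg_left h₂ hm.le]
      have h₄ : 1 + (u - p) * M ≤ Real.exp ((M + 1) * (u - p)) := by
        have := Real.add_one_le_exp ((M + 1) * (u - p))
        nlinarith
      have h₅ : Real.exp ((M + 1) * (u - p)) * B p = B u := by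
        simp only [hBdef]
        rw [mul_left_comm, ← Real.exp_add]
        ring_nf
      have h₆ : (1 + (u - p) * M) * r p ≤ (1 + (u - p) * M) * B p :=
        mul_le_mul_of_nonneg_left (hbelow p hp hρ) (by positivity)
      have h₇ := mul_le_mul_of_nonneg_right h₄ (hB0 p).le
      linarith
    -- At a left-dense `u` the bound passes to the limit by continuity.
    · have hcl : u ∈ closure (T ∩ Iio u) := by
        have := rho_mem_closure ⟨a, haT.1, hau⟩
        rwa [hρ] at this
      have : (𝓝[T ∩ Iio u] u).NeBot := mem_closure_iff_nhdsWithin_neBot.1 hcl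
      have huκ : u ∈ kappa T := ⟨hu, fun h => h.2.ne hρ⟩
      refine hru.not_ge (le_of_tendsto_of_tendsto
        (((hr u huκ).continuousWithinAt hu).mono (inter_subset_left (t := Iio u))).tendsto
        (hBd u).continuousAt.continuousWithinAt.tendsto ?_)
      filter_upwards [self_mem_nhdsWithin] with s hs using hbelow s hs.1 hs.2

/-- Comparison of two solutions through the trace of their difference. -/
theorem trace_sub_nonpos {n : ℕ} {T : Set ℝ} (hT : IsCompact T) {a : ℝ} (haT : IsLeast T a)
    {A : Matrix (Fin n) (Fin n) ℝ} {S : Set (Matrix (Fin n) (Fin n) ℝ)}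
    {F : ℝ → Matrix (Fin n) (Fin n) ℝ → Matrix (Fin n) (Fin n) ℝ}
    {C : ℝ → Matrix (Fin n) (Fin n) ℝ} (hCpos : ∀ t ∈ T, (C t).PosDef) (hCrd : RdContinuous T C)
    (hpos : ∀ P ∈ S, ∀ Q ∈ S, P ≠ Q → (P - Q).PosDef ∨ (Q - P).PosDef)
    (hinc : ∀ P ∈ S, ∀ Q ∈ S, (P - Q).PosDef → ∀ t ∈ kappa T, (F t P - F t Q).PosDef)
    (hinv : ∀ P ∈ S, ∀ Q ∈ S, (P - Q).PosDef → ∀ t ∈ kappa T,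
      QuadLE (P - Q)⁻¹ ((-ominus T C t) * (F t P - F t Q)⁻¹))
    {X Y : ℝ → Matrix (Fin n) (Fin n) ℝ} (hX : IsShiftedSolution T a A S F X)
    (hY : IsShiftedSolution T a A S F Y) : ∀ t ∈ T, (X t - Y t).trace ≤ 0 := by
  obtain ⟨M₀, hM₀⟩ := hCrd.bddAbove_image hT continuous_id.matrix_trace
  rw [mem_upperBounds, forall_mem_image] at hM₀
  -- The maximum with 1 only ensures `M > 0`.
  set M := max M₀ 1
  have hM : 0 < M := zero_lt_one.trans_le (le_max_right _ _)
  refine nonpos_of_deltaDeriv_le hT.isClosed haT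
    (r' := fun t => (F t (X (sigma T t)) - F t (Y (sigma T t))).trace) hM (fun t ht => ?_)
    (by simp [hX.1, hY.1]) fun t ht hlt => ?_
  · simpa only [Matrix.trace_sub] using (hX.2.2 t ht).trace.sub (hY.2.2 t ht).trace
  · have hσ := sigma_mem hT.isClosed ht.1
    have hP := hX.2.1 _ hσ
    have hQ := hY.2.1 _ hσ
    have hR : (X (sigma T t) - Y (sigma T t)).PosDef := by
      refine (hpos _ hP _ hQ ?_).resolve_right fun h => ?_
      · intro h
        simp [h] at hlt
      · have := h.posSemidef.trace_nonneg
        rw [Matrix.trace_sub] at hlt this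
        linarith
    have hμ : 0 ≤ mu T t := sub_nonneg.2 (le_sigma T t)
    have h := hinv _ hP _ hQ hR t ht
    rw [ominus, neg_neg] at h
    exact trace_le_of_quadLE_inv (hinc _ hP _ hQ hR t ht) hR (by positivity)
      ((hCpos t ht.1).smul_one_sub_resolvent_mul hM hμ
        ((hCpos t ht.1).posSemidef.smul_one_sub_of_trace_le
          ((hM₀ ht.1).trans (le_max_left _ _)))) h

end TimeScale

/-- The time scale on which everything takes place is the interval `[a,b]_𝕋 = [a,b] ∩ 𝕋`.
Along the equation `P^Δ` stands for `F(t,P)`; `Matrix.PosDef` includes symmetry. -/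
theorem mainTheorem11 {n : ℕ} (𝕋 : Set ℝ) (h𝕋 : IsClosed 𝕋)
    (a b : ℝ) (ha : a ∈ 𝕋) (hb : b ∈ 𝕋) (hab : a < b)
    (J : Set ℝ) (hJ : J = Set.Icc a b ∩ 𝕋)
    (A : Matrix (Fin n) (Fin n) ℝ)
    (S : Set (Matrix (Fin n) (Fin n) ℝ))
    (F : ℝ → Matrix (Fin n) (Fin n) ℝ → Matrix (Fin n) (Fin n) ℝ)
    (hF : TimeScale.RightHilgerContinuous J S F)
    (C : ℝ → Matrix (Fin n) (Fin n) ℝ)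
    (hCpos : ∀ t ∈ J, (C t).PosDef)
    -- (1) `C` is rd-continuous
    (hCrd : TimeScale.RdContinuous J C)
    -- (2) `e_C(t,a)` commutes with `C(t)` and with every element of `S`
    (E : ℝ → Matrix (Fin n) (Fin n) ℝ) (hE : TimeScale.IsMatrixExp J a C E)
    (hEC : ∀ t ∈ J, Commute (E t) (C t))
    (hES : ∀ t ∈ J, ∀ P ∈ S, Commute (E t) P)
    -- differences of distinct elements of `S`, taken in the right order, are positive definite
    (hpos : ∀ P ∈ S, ∀ Q ∈ S, P ≠ Q → (P - Q).PosDef ∨ (Q - P).PosDef)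
    -- and increasing: `P^Δ - Q^Δ > 0`
    (hinc : ∀ P ∈ S, ∀ Q ∈ S, (P - Q).PosDef →
      ∀ t ∈ TimeScale.kappa J, (F t P - F t Q).PosDef)
    -- the inverse Lipschitz condition `(P - Q)⁻¹ ≤ (-⊖C)(P^Δ - Q^Δ)⁻¹`
    (hinv : ∀ P ∈ S, ∀ Q ∈ S, (P - Q).PosDef → ∀ t ∈ TimeScale.kappa J,
      TimeScale.QuadLE (P - Q)⁻¹ ((-TimeScale.ominus J C t) * (F t P - F t Q)⁻¹)) :
    ∀ X Y : ℝ → Matrix (Fin n) (Fin n) ℝ,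
      TimeScale.IsShiftedSolution J a A S F X → TimeScale.IsShiftedSolution J a A S F Y →
      Set.EqOn X Y J := by
  intro X Y hX hY t ht
  have hJc : IsCompact J := hJ ▸ isCompact_Icc.inter_right h𝕋
  have haJ : IsLeast J a := by
    rw [hJ]
    exact ⟨⟨⟨le_rfl, hab.le⟩, ha⟩, fun s hs => hs.1.1⟩
  by_contra hne
  have hXY := TimeScale.trace_sub_nonpos hJc haJ hCpos hCrd hpos hinc hinv hX hY t ht
  have hYX := TimeScale.trace_sub_nonpos hJc haJ hCpos hCrd hpos hinc hinv hY hX t ht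
  -- For `n = 0` a positive definite matrix has trace zero, so this case is excluded separately.
  have : Nonempty (Fin n) := by
    by_contra h
    rw [not_nonempty_iff] at h
    exact hne (Subsingleton.elim _ _)
  rcases hpos _ (hX.2.1 t ht) _ (hY.2.1 t ht) hne with h | h
  · exact hXY.not_gt h.trace_pos
  · exact hYX.not_gt h.trace_pos
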